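/- \textbf{Theorem (finite-time breakdown, repulsive case).} Let $\nu\ge 0$ and $0<c_-\le c_+$, and let $c:[0,\infty)\times\mathbb R\to\mathbb R$ be a continuous background with $c_-\le c(t,x)\le c_+$ for all $(t,x)$. Consider the repulsive Euler--Poisson system $$\partial_t\rho+\partial_x(\rho u)=0,\qquad \partial_t u+u\,\partial_x u=-\nu u-\partial_x\phi,\qquad -\partial_{xx}\phi=\rho-c \qquad\text{in }(0,T)\times\mathbb R,$$ with initial data $(\rho,u)(0,\cdot)=(\rho_0,u_0)$. A function $f$ is said to be of class $\mathcal C^1$ on $[0,T)\times\mathbb R$ if it is continuously differentiable there and $|f|+|\partial_t f|+|\partial_x f|$ is bounded on $[0,T']\times\mathbb R$ for every $T'<T$; a $\mathcal C^1$ solution on $[0,T)$ is a pair $(\rho,u)$ of functions of class $\mathcal C^1$ on $[0,T)\times\mathbb R$ that satisfies the system pointwise for some potential $\phi$. Let $P_-$ be the maximal nonnegative solution of $$\frac{dP}{ds}=\nu\sqrt{2P}+1-c_-s,\qquad P(0)=0,$$ and, when $\nu<2\sqrt{c_-}$, let $N_+$ be the maximal nonnegative solution of $$\frac{dN}{ds}=-\nu\sqrt{2N}+1-c_+s,\qquad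 N(s_*)=0,\qquad s_*:=\frac{1}{c_-}\Bigl(1+\exp\Bigl(\tfrac{\pi\nu}{\sqrt{4c_--\nu^2}}\Bigr)\Bigr).$$ Suppose that there is a point $x\in\mathbb R$ with $\rho_0(x)>0$ at which the following condition fails: - if $\nu\ge 2\sqrt{c_-}$: $\quad -\rho_0(x)\sqrt{2P_-(1/\rho_0(x))}<u_0'(x)$; - if $0\le\nu<2\sqrt{c_-}$: $\quad -\rho_0(x)\sqrt{2P_-(1/\rho_0(x))}<u_0'(x)<\rho_0(x)\sqrt{2N_+(1/\rho_0(x))}$. Here the condition also counts as failing if $1/\rho_0(x)$ lies outside the domain of a function that occurs in it. Then the $\mathcal C^1$ regularity is lost in finite time: there is $T_*\in(0,\infty)$ such that every $\mathcal C^1$ solution on $[0,T)$ with initial data $(\rho_0,u_0)$ has $T\le T_*$. -/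

import Mathlib

open Set

noncomputable section

namespace EulerPoisson

/-- `f` is of class `C¹` on `[0,T) × ℝ`: it is continuously differentiable there (one-sidedly in
time at `t = 0`), and `|f| + |∂ₜ f| + |∂ₓ f|` is bounded on `[0,T'] × ℝ` for every `T' < T`. -/
def IsClassC1 (T : ℝ) (f : ℝ → ℝ → ℝ) : Prop :=
  ContDiffOn ℝ 1 (Function.uncurry f) (Ico 0 T ×ˢ univ) ∧
  ∀ T' < T, ∃ M : ℝ, ∀ t ∈ Icc 0 T', ∀ x : ℝ,
    |f t x| + |derivWithin (fun τ => f τ x) (Ico 0 T) t| + |deriv (f t) x| ≤ M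

/-- `(ρ, u)` is a `C¹` solution on `[0,T) × ℝ` of the damped pressureless Euler-Poisson system with
forcing constant `k`, damping `ν` and background `c`, for some potential `φ`:
`∂ₜρ + ∂ₓ(ρu) = 0`, `∂ₜu + u ∂ₓu = -νu - k ∂ₓφ`, `-∂ₓₓφ = ρ - c` pointwise in `(0,T) × ℝ`.
The first argument of every function is time, the second one is space. -/
def IsC1Solution (k ν : ℝ) (c : ℝ → ℝ → ℝ) (T : ℝ) (ρ u : ℝ → ℝ → ℝ) : Prop :=
  0 < T ∧ IsClassC1 T ρ ∧ IsClassC1 T u ∧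
  ∃ φ : ℝ → ℝ → ℝ, ∀ t ∈ Ioo 0 T, ∀ x : ℝ,
    deriv (fun τ => ρ τ x) t + deriv (fun y => ρ t y * u t y) x = 0 ∧
    deriv (fun τ => u τ x) t + u t x * deriv (u t) x = -ν * u t x - k * deriv (φ t) x ∧
    DifferentiableAt ℝ (φ t) x ∧
    HasDerivAt (deriv (φ t)) (-(ρ t x - c t x)) x

/-- `f` is a nonnegative solution of `y' = F s y`, `y a = 0`, on the closed interval with
endpoints `a` and `b` (one-sided derivatives at the endpoints). -/
def SolvesOn (F : ℝ → ℝ → ℝ) (a b : ℝ) (f : ℝ → ℝ) : Prop :=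
  f a = 0 ∧ ∀ s ∈ uIcc a b, 0 ≤ f s ∧ HasDerivWithinAt f (F s (f s)) (uIcc a b) s

/-- The domain of the maximal nonnegative solution of `y' = F s y`, `y a = 0`. -/
def solDom (F : ℝ → ℝ → ℝ) (a : ℝ) : Set ℝ :=
  {s | ∃ f, SolvesOn F a s f}

open Classical in
/-- The maximal nonnegative solution of `y' = F s y`, `y a = 0`: its value at `s ∈ solDom F a` is
the value at `s` of a solution on the interval between `a` and `s`. -/
def maxSol (F : ℝ → ℝ → ℝ) (a : ℝ) (s : ℝ) : ℝ :=
  if h : s ∈ solDom F a then h.choose s else 0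

/-- Right-hand side of `dP/ds = ν √(2P) + 1 - c s`. -/
def fieldP (ν c s y : ℝ) : ℝ := ν * √(2 * y) + 1 - c * s

/-- Right-hand side of `dN/ds = -ν √(2N) + 1 - c s`. -/
def fieldN (ν c s y : ℝ) : ℝ := -ν * √(2 * y) + 1 - c * s

/-- Domain of `P`, the maximal solution of `dP/ds = ν √(2P) + 1 - c s`, `P(0) = 0`. -/
def domP (ν c : ℝ) : Set ℝ := solDom (fieldP ν c) 0

/-- `P`, the maximal solution of `dP/ds = ν √(2P) + 1 - c s`, `P(0) = 0`. -/
def P (ν c : ℝ) : ℝ → ℝ := maxSol (fieldP ν c) 0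

/-- `s̃ = (1 + e^γ) / c`, `γ = π ν / √(4c - ν²)`, used only for `0 ≤ ν < 2√c`. -/
def sTilde (ν c : ℝ) : ℝ := (1 + Real.exp (Real.pi * ν / √(4 * c - ν ^ 2))) / c

/-- Domain of `N`, the maximal solution of `dN/ds = -ν √(2N) + 1 - c s`, `N(sStar) = 0`. -/
def domN (ν c sStar : ℝ) : Set ℝ := solDom (fieldN ν c) sStar

/-- `N`, the maximal solution of `dN/ds = -ν √(2N) + 1 - c s`, `N(sStar) = 0`. -/
def N (ν c sStar : ℝ) : ℝ → ℝ := maxSol (fieldN ν c) sStar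

end EulerPoisson

end

open Set

namespace EulerPoisson

/-! Along a characteristic, the specific volume `s = 1/ρ` and its time derivative `p = u_x/ρ`
satisfy `s'' + ν s' + κ s = 1`, where `κ(t)` is the background along the curve and lies in `[cm,
cp]`. A `C¹` solution keeps `s` positive, so it suffices to show that the oscillator forces `s` to
zero by a time depending only on `s 0`, `p 0` and the constants (`exists_breakdown_time`).

Duhamel's formula compares `s` with the constant-coefficient solutions for `cm` (from above) and
`cp` (from below), as long as the impulse response is nonnegative, that is, for half a period of the
oscillator, or forever if it is overdamped (`trajectory_le`, `le_trajectory`).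

The critical curves are phase-plane orbits run backwards. The curve `p = -√(2P(s))` is the backward
`cm`-orbit of the origin; a trajectory starting on or below it is driven to zero
(`lt_of_le_backStep`). The curve `p = √(2N(s))` is the backward `cp`-orbit of the rest point `(s̃,
0)`; starting on or above it forces `s` up to `s̃`, and from there the oscillator swings back to
zero within half a `cm`-period, whatever its velocity (`lt_of_sTilde_le`). Since `P` and `N` come
from equations singular at `y = 0`, existence and uniqueness along these orbits are proved in
`mem_solDom_of_orbit` and `SolvesOn.eq_orbit`.

On the PDE side, `u_x` is only continuous, so its Riccati equation along characteristics is obtained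
by passing to the limit in difference quotients (`hasDerivAt_velocityGradient`). -/

/-- `G` (with derivative `G'`) is the impulse response of `y'' + ν y' + c y`. -/
structure IsImpulse (ν c : ℝ) (G G' : ℝ → ℝ) : Prop where
  hasDerivAt : ∀ t, HasDerivAt G (G' t) t
  hasDerivAt' : ∀ t, HasDerivAt G' (-ν * G' t - c * G t) t
  zero : G 0 = 0
  one : G' 0 = 1

/-- `s` is a positive solution on `[0,b]` of `s'' + ν s' + κ s = 1`, with `p = s'`. -/
structure IsTrajectory (ν b : ℝ) (κ s p : ℝ → ℝ) : Prop where
  contS : ContinuousOn s (Icc 0 b)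
  contP : ContinuousOn p (Icc 0 b)
  derivS : ∀ t ∈ Ioo 0 b, HasDerivAt s (p t) t
  derivP : ∀ t ∈ Ioo 0 b, HasDerivAt p (1 - ν * p t - κ t * s t) t
  pos : ∀ t ∈ Icc 0 b, 0 < s t

/-- Step response of `y'' + ν y' + c y`, the primitive of the impulse response. -/
noncomputable def step (ν c : ℝ) (G G' : ℝ → ℝ) (t : ℝ) : ℝ := (1 - G' t - ν * G t) / c

/-- Step response of the time-reversed operator `y'' - ν y' + c y`. -/
noncomputable def backStep (ν c : ℝ) (G' : ℝ → ℝ) (t : ℝ) : ℝ := (1 - Real.exp (ν * t) * G' t) / c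

/-! ### Constant-coefficient oscillators and Duhamel comparison -/

namespace IsImpulse

variable {ν c : ℝ} {G G' : ℝ → ℝ}

theorem hasDerivAt_step (h : IsImpulse ν c G G') (hc : c ≠ 0) (t : ℝ) :
    HasDerivAt (step ν c G G') (G t) t := by
  have := (((h.hasDerivAt' t).const_sub 1).sub ((h.hasDerivAt t).const_mul ν)).div_const c
  refine this.congr_deriv ?_
  field_simp
  ring

theorem hasDerivAt_backStep (h : IsImpulse ν c G G') (hc : c ≠ 0) (t : ℝ) :
    HasDerivAt (backStep ν c G') (Real.exp (ν * t) * G t) t := by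
  have he : HasDerivAt (fun t => Real.exp (ν * t)) (Real.exp (ν * t) * ν) t := by
    simpa using ((hasDerivAt_id t).const_mul ν).exp
  have := ((he.mul (h.hasDerivAt' t)).const_sub 1).div_const c
  refine this.congr_deriv ?_
  field_simp
  ring

/-- With `S = backStep` and `q = S' = exp (ν t) * G`, this is the time-reversed oscillator `q' = ν q
+ 1 - c S`. Hence `q²/2`, viewed as a function of `S` where `q > 0`, solves the equation that
defines `P`. -/
theorem hasDerivAt_exp_mul (h : IsImpulse ν c G G') (hc : c ≠ 0) (t : ℝ) :
    HasDerivAt (fun t => Real.exp (ν * t) * G t)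
      (ν * (Real.exp (ν * t) * G t) + 1 - c * backStep ν c G' t) t := by
  have he : HasDerivAt (fun t => Real.exp (ν * t)) (Real.exp (ν * t) * ν) t := by
    simpa using ((hasDerivAt_id t).const_mul ν).exp
  refine (he.mul (h.hasDerivAt t)).congr_deriv ?_
  unfold backStep
  field_simp
  ring

theorem step_zero (h : IsImpulse ν c G G') : step ν c G G' 0 = 0 := by
  simp [step, h.zero, h.one]

theorem backStep_zero (h : IsImpulse ν c G G') : backStep ν c G' 0 = 0 := by
  simp [backStep, h.one]

/-- The quadratic form is chosen so that along the damped oscillator it decays exactly like `exp (-ν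
t)`. -/
theorem exp_mul_energy (h : IsImpulse ν c G G') (t : ℝ) :
    Real.exp (ν * t) * (G' t ^ 2 + ν * G t * G' t + c * G t ^ 2) = 1 := by
  have hd : ∀ t, HasDerivAt
      (fun t => Real.exp (ν * t) * (G' t ^ 2 + ν * G t * G' t + c * G t ^ 2)) 0 t := by
    intro t
    have he : HasDerivAt (fun t => Real.exp (ν * t)) (Real.exp (ν * t) * ν) t := by
      simpa using ((hasDerivAt_id t).const_mul ν).exp
    have := he.mul ((((h.hasDerivAt' t).pow 2).add
      (((h.hasDerivAt t).const_mul ν).mul (h.hasDerivAt' t))).add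
      (((h.hasDerivAt t).pow 2).const_mul c))
    refine this.congr_deriv ?_
    simp
    ring
  have := is_const_of_deriv_eq_zero (fun t => (hd t).differentiableAt) (fun t => (hd t).deriv) t 0
  simpa [h.zero, h.one] using this

/-- The backward orbit of the origin returns to the origin. -/
theorem backStep_return (h : IsImpulse ν c G G') (hc : c ≠ 0) (t : ℝ) :
    backStep ν c G' t - Real.exp (ν * t) * G t * G t
      + (1 - c * backStep ν c G' t) * step ν c G G' t = 0 := by
  -- Since `1 - c * backStep = exp (ν t) * G'`, the claim multiplied by `c` is exactly the energy
  -- identity.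
  have := h.exp_mul_energy t
  unfold backStep step
  field_simp
  linear_combination -this

variable {b : ℝ} {κ s p : ℝ → ℝ}

/-- The differentiated quantity is the value at time `e` of the solution with constant coefficient
`c` restarted at time `t` from `(s t, p t)`. Only the mismatch `c - κ t` makes it vary, so its
monotonicity follows from the signs of that mismatch, `s` and `G`. At `t = e` it equals `s e`. -/
theorem hasDerivAt_duhamel (h : IsImpulse ν c G G') (hc : c ≠ 0) (hs : IsTrajectory ν b κ s p)
    (e : ℝ) {t : ℝ} (ht : t ∈ Ioo 0 b) :
    HasDerivAt (fun t => p t * G (e - t) + s t * (G' (e - t) + ν * G (e - t))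
      + step ν c G G' (e - t)) ((c - κ t) * s t * G (e - t)) t := by
  have hr : HasDerivAt (fun t => e - t) (-1) t := (hasDerivAt_id t).const_sub e
  have h1 := (h.hasDerivAt (e - t)).comp t hr
  have h2 := (h.hasDerivAt' (e - t)).comp t hr
  have h3 := (h.hasDerivAt_step hc (e - t)).comp t hr
  have := (((hs.derivP t ht).mul h1).add ((hs.derivS t ht).mul (h2.add (h1.const_mul ν)))).add h3
  refine this.congr_deriv ?_
  simp
  ring

theorem continuousOn_duhamel (h : IsImpulse ν c G G') (hc : c ≠ 0) (hs : IsTrajectory ν b κ s p)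
    (e : ℝ) :
    ContinuousOn (fun t => p t * G (e - t) + s t * (G' (e - t) + ν * G (e - t))
      + step ν c G G' (e - t)) (Icc 0 b) := by
  have c1 : Continuous G := continuous_iff_continuousAt.2 fun t => (h.hasDerivAt t).continuousAt
  have c2 : Continuous G' := continuous_iff_continuousAt.2 fun t => (h.hasDerivAt' t).continuousAt
  have c3 : Continuous (step ν c G G') :=
    continuous_iff_continuousAt.2 fun t => (h.hasDerivAt_step hc t).continuousAt
  have := hs.contS
  have := hs.contP
  fun_prop

/-- A trajectory lies below the constant-coefficient solution of a smaller coefficient. -/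
theorem trajectory_le (h : IsImpulse ν c G G') (hc : c ≠ 0) (hs : IsTrajectory ν b κ s p)
    (hκ : ∀ t ∈ Ioo 0 b, c ≤ κ t) {t₀ t₁ : ℝ} (h0 : 0 ≤ t₀) (h1 : 0 ≤ t₁) (hb : t₀ + t₁ ≤ b)
    (hG : ∀ t ∈ Icc 0 t₁, 0 ≤ G t) :
    s (t₀ + t₁) ≤ s t₀ + p t₀ * G t₁ + (1 - c * s t₀) * step ν c G G' t₁ := by
  have key : AntitoneOn (fun t => p t * G (t₀ + t₁ - t)
      + s t * (G' (t₀ + t₁ - t) + ν * G (t₀ + t₁ - t))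
      + step ν c G G' (t₀ + t₁ - t)) (Icc t₀ (t₀ + t₁)) := by
    refine antitoneOn_of_hasDerivWithinAt_nonpos (convex_Icc _ _)
      ((h.continuousOn_duhamel hc hs _).mono (Icc_subset_Icc h0 hb))
      (f' := fun t => (c - κ t) * s t * G (t₀ + t₁ - t)) ?_ ?_
    · intro t ht
      rw [interior_Icc] at ht
      exact (h.hasDerivAt_duhamel hc hs _ ⟨by linarith [ht.1], by linarith [ht.2]⟩).hasDerivWithinAt
    · intro t ht
      rw [interior_Icc] at ht
      have ht' : t ∈ Ioo 0 b := ⟨by linarith [ht.1], by linarith [ht.2]⟩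
      refine mul_nonpos_of_nonpos_of_nonneg (mul_nonpos_of_nonpos_of_nonneg ?_ ?_) ?_
      · linarith [hκ t ht']
      · exact (hs.pos t (Ioo_subset_Icc_self ht')).le
      · exact hG _ ⟨by linarith [ht.2], by linarith [ht.1]⟩
  have := key (left_mem_Icc.2 (by linarith)) (right_mem_Icc.2 (by linarith)) (by linarith)
  simp only [sub_self, h.zero, h.one, h.step_zero, add_sub_cancel_left] at this
  have e : G' t₁ + ν * G t₁ = 1 - c * step ν c G G' t₁ := by
    unfold step; field_simp; ring
  rw [e] at this
  linarith

/-- A trajectory lies above the constant-coefficient solution of a larger coefficient. -/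
theorem le_trajectory (h : IsImpulse ν c G G') (hc : c ≠ 0) (hs : IsTrajectory ν b κ s p)
    (hκ : ∀ t ∈ Ioo 0 b, κ t ≤ c) {t₁ : ℝ} (h1 : 0 ≤ t₁) (hb : t₁ ≤ b)
    (hG : ∀ t ∈ Icc 0 t₁, 0 ≤ G t) :
    s 0 + p 0 * G t₁ + (1 - c * s 0) * step ν c G G' t₁ ≤ s t₁ := by
  have key : MonotoneOn (fun t => p t * G (t₁ - t)
      + s t * (G' (t₁ - t) + ν * G (t₁ - t))
      + step ν c G G' (t₁ - t)) (Icc 0 t₁) := by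
    refine monotoneOn_of_hasDerivWithinAt_nonneg (convex_Icc _ _)
      ((h.continuousOn_duhamel hc hs _).mono (Icc_subset_Icc le_rfl hb))
      (f' := fun t => (c - κ t) * s t * G (t₁ - t)) ?_ ?_
    · intro t ht
      rw [interior_Icc] at ht
      exact (h.hasDerivAt_duhamel hc hs _ ⟨by linarith [ht.1], by linarith [ht.2]⟩).hasDerivWithinAt
    · intro t ht
      rw [interior_Icc] at ht
      have ht' : t ∈ Ioo 0 b := ⟨by linarith [ht.1], by linarith [ht.2]⟩
      refine mul_nonneg (mul_nonneg ?_ ?_) ?_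
      · linarith [hκ t ht']
      · exact (hs.pos t (Ioo_subset_Icc_self ht')).le
      · exact hG _ ⟨by linarith [ht.2], by linarith [ht.1]⟩
  have := key (left_mem_Icc.2 h1) (right_mem_Icc.2 h1) h1
  simp only [sub_self, h.zero, h.one, h.step_zero, sub_zero] at this
  have e : G' t₁ + ν * G t₁ = 1 - c * step ν c G G' t₁ := by
    unfold step; field_simp; ring
  rw [e] at this
  linarith

end IsImpulse

/-! ### Explicit impulse responses -/

/-- Impulse response in the underdamped regime. -/
theorem exists_isImpulse_underdamped {ν c : ℝ} (h : ν ^ 2 < 4 * c) :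
    ∃ G G' : ℝ → ℝ, IsImpulse ν c G G' ∧
      (∀ t ∈ Ioo 0 (2 * Real.pi / √(4 * c - ν ^ 2)), 0 < G t) ∧
      G (2 * Real.pi / √(4 * c - ν ^ 2)) = 0 ∧
      G' (2 * Real.pi / √(4 * c - ν ^ 2)) = -Real.exp (-(Real.pi * ν / √(4 * c - ν ^ 2))) := by
  set D := √(4 * c - ν ^ 2) with hD
  have hDpos : 0 < D := Real.sqrt_pos.2 (by linarith)
  have hD2 : D ^ 2 = 4 * c - ν ^ 2 := Real.sq_sqrt (by linarith)
  have he : ∀ t, HasDerivAt (fun t => Real.exp (-(ν / 2) * t))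
      (Real.exp (-(ν / 2) * t) * -(ν / 2)) t := fun t => by
    simpa using ((hasDerivAt_id t).const_mul (-(ν / 2))).exp
  have hs : ∀ t, HasDerivAt (fun t => Real.sin (D / 2 * t))
      (Real.cos (D / 2 * t) * (D / 2)) t := fun t => by
    simpa using ((hasDerivAt_id t).const_mul (D / 2)).sin
  have hco : ∀ t, HasDerivAt (fun t => Real.cos (D / 2 * t))
      (-Real.sin (D / 2 * t) * (D / 2)) t := fun t => by
    simpa using ((hasDerivAt_id t).const_mul (D / 2)).cos
  refine ⟨fun t => Real.exp (-(ν / 2) * t) * (Real.sin (D / 2 * t) * (2 / D)),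
    fun t => Real.exp (-(ν / 2) * t) * (Real.cos (D / 2 * t)
      - ν / D * Real.sin (D / 2 * t)), ⟨?_, ?_, ?_, ?_⟩, ?_, ?_, ?_⟩
  · intro t
    refine ((he t).mul ((hs t).mul_const (2 / D))).congr_deriv ?_
    field_simp
    ring
  · intro t
    refine ((he t).mul ((hco t).sub ((hs t).const_mul (ν / D)))).congr_deriv ?_
    have : c = (D ^ 2 + ν ^ 2) / 4 := by linarith
    rw [this, Pi.sub_apply]
    field_simp
    ring
  · simp
  · simp
  · intro t ht
    refine mul_pos (Real.exp_pos _) (mul_pos (Real.sin_pos_of_pos_of_lt_pi ?_ ?_) (by positivity))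
    · exact mul_pos (by positivity) ht.1
    · have := ht.2
      rw [lt_div_iff₀ hDpos] at this
      linarith
  · have : D / 2 * (2 * Real.pi / D) = Real.pi := by field_simp
    simp [this]
  · have : D / 2 * (2 * Real.pi / D) = Real.pi := by field_simp
    have h2 : -(ν / 2) * (2 * Real.pi / D) = -(Real.pi * ν / D) := by field_simp
    simp [this, h2]

/-- Impulse response in the overdamped regime. -/
theorem exists_isImpulse_overdamped {ν c : ℝ} (h : 4 * c ≤ ν ^ 2) :
    ∃ G G' : ℝ → ℝ, IsImpulse ν c G G' ∧ ∀ t, 0 ≤ t → Real.exp (-(ν / 2) * t) * t ≤ G t := by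
  have he : ∀ t, HasDerivAt (fun t => Real.exp (-(ν / 2) * t))
      (Real.exp (-(ν / 2) * t) * -(ν / 2)) t := fun t => by
    simpa using ((hasDerivAt_id t).const_mul (-(ν / 2))).exp
  rcases h.eq_or_lt with h | h
  · refine ⟨fun t => Real.exp (-(ν / 2) * t) * t,
      fun t => Real.exp (-(ν / 2) * t) * (1 - ν / 2 * t), ⟨?_, ?_, ?_, ?_⟩, fun t _ => le_rfl⟩
    · intro t
      refine ((he t).mul (hasDerivAt_id t)).congr_deriv ?_
      simp
      ring
    · intro t
      refine ((he t).mul (((hasDerivAt_id t).const_mul (ν / 2)).const_sub 1)).congr_deriv ?_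
      have : c = ν ^ 2 / 4 := by linarith
      rw [this]
      simp
      ring
    · simp
    · simp
  · set D := √(ν ^ 2 - 4 * c) with hD
    have hDpos : 0 < D := Real.sqrt_pos.2 (by linarith)
    have hD2 : D ^ 2 = ν ^ 2 - 4 * c := Real.sq_sqrt (by linarith)
    have hs : ∀ t, HasDerivAt (fun t => Real.sinh (D / 2 * t))
        (Real.cosh (D / 2 * t) * (D / 2)) t := fun t => by
      simpa using ((hasDerivAt_id t).const_mul (D / 2)).sinh
    have hco : ∀ t, HasDerivAt (fun t => Real.cosh (D / 2 * t))
        (Real.sinh (D / 2 * t) * (D / 2)) t := fun t => by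
      simpa using ((hasDerivAt_id t).const_mul (D / 2)).cosh
    refine ⟨fun t => Real.exp (-(ν / 2) * t) * (Real.sinh (D / 2 * t) * (2 / D)),
      fun t => Real.exp (-(ν / 2) * t) * (Real.cosh (D / 2 * t)
        - ν / D * Real.sinh (D / 2 * t)), ⟨?_, ?_, ?_, ?_⟩, ?_⟩
    · intro t
      refine ((he t).mul ((hs t).mul_const (2 / D))).congr_deriv ?_
      field_simp
      ring
    · intro t
      refine ((he t).mul ((hco t).sub ((hs t).const_mul (ν / D)))).congr_deriv ?_
      have : c = (ν ^ 2 - D ^ 2) / 4 := by linarith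
      rw [this, Pi.sub_apply]
      field_simp
      ring
    · simp
    · simp
    · intro t ht
      refine mul_le_mul_of_nonneg_left ?_ (Real.exp_pos _).le
      have : D / 2 * t ≤ Real.sinh (D / 2 * t) := Real.self_le_sinh_iff.2 (by positivity)
      calc t = D / 2 * t * (2 / D) := by field_simp
        _ ≤ _ := mul_le_mul_of_nonneg_right this (by positivity)

/-! ### Critical curves as backward orbits -/

open Filter Topology

/-- Compactness gives cluster points: any cluster point of `ρ` at `s` lies in `K` and is mapped to
`s` by `S`, so injectivity identifies it with `ρ s`. -/
theorem continuousOn_of_leftInverse {S ρ : ℝ → ℝ} {K U : Set ℝ} (hK : IsCompact K)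
    (hS : Continuous S) (hinj : InjOn S K) (hρ : MapsTo ρ U K) (hr : ∀ s ∈ U, S (ρ s) = s) :
    ContinuousOn ρ U := by
  intro s hs
  refine hK.tendsto_nhds_of_unique_mapClusterPt
    (eventually_nhdsWithin_of_forall fun x hx => hρ hx) fun y hy hc => ?_
  refine hinj hy (hρ hs) ?_
  have h1 : MapClusterPt (S y) (𝓝[U] s) (S ∘ ρ) := hc.continuousAt_comp hS.continuousAt
  have h2 : Tendsto (S ∘ ρ) (𝓝[U] s) (𝓝 s) :=
    (tendsto_id.mono_left nhdsWithin_le_nhds).congr'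
      (eventually_nhdsWithin_of_forall fun x hx => (hr x hx).symm)
  rw [hr s hs]
  have h3 : ClusterPt (S y) (𝓝 s) := h1.clusterPt.mono h2
  exact eq_of_nhds_neBot h3

/-- An orbit of `S'' = F(S, S'²/2)` starting at rest yields a solution of `dy/ds = F(s, y)`. -/
theorem mem_solDom_of_orbit {F : ℝ → ℝ → ℝ} {S S₁ S₂ : ℝ → ℝ} {r₀ : ℝ} (hr : 0 ≤ r₀)
    (hS : ∀ r, HasDerivAt S (S₁ r) r) (hS₁ : ∀ r, HasDerivAt S₁ (S₂ r) r) (hS₂ : Continuous S₂)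
    (h0 : S₁ 0 = 0) (hne : ∀ r ∈ Ioo 0 r₀, S₁ r ≠ 0) (hinj : InjOn S (Icc 0 r₀))
    (hF : ∀ r ∈ Icc 0 r₀, F (S r) (S₁ r ^ 2 / 2) = S₂ r) : S r₀ ∈ solDom F (S 0) := by
  have cS : Continuous S := continuous_iff_continuousAt.2 fun t => (hS t).continuousAt
  set U := uIcc (S 0) (S r₀)
  have himg : ∀ s ∈ U, ∃ r ∈ Icc 0 r₀, S r = s := fun s hs => by
    have := intermediate_value_uIcc (cS.continuousOn (s := uIcc 0 r₀)) hs
    rwa [uIcc_of_le hr] at this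
  choose! ρ hρ hSρ using himg
  have cρ : ContinuousOn ρ U := continuousOn_of_leftInverse isCompact_Icc cS hinj hρ hSρ
  have h0r : (0 : ℝ) ∈ Icc 0 r₀ := left_mem_Icc.2 hr
  -- `S₁` vanishes at the starting point, so the inverse `ρ` of `S` need not be differentiable
  -- there. Cauchy's mean value theorem bypasses this: difference quotients of `S₁²/2` with respect
  -- to `S` equal `S₂ ξ`, the factor `S₁ ξ` cancelling at interior points.
  have hmvt : ∀ a b, a ∈ Icc 0 r₀ → b ∈ Icc 0 r₀ → a < b → ∃ ξ ∈ Icc a b,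
      S₁ b ^ 2 / 2 - S₁ a ^ 2 / 2 = (S b - S a) * S₂ ξ := by
    intro a b ha hb hab
    have hd : ∀ r, HasDerivAt (fun r => S₁ r ^ 2 / 2) (S₁ r * S₂ r) r := fun r => by
      refine (((hS₁ r).pow 2).div_const 2).congr_deriv ?_
      simp
      ring
    obtain ⟨ξ, hξ, e⟩ := exists_ratio_hasDerivAt_eq_ratio_slope S S₁ hab cS.continuousOn
      (fun r _ => hS r) (fun r => S₁ r ^ 2 / 2) (fun r => S₁ r * S₂ r)
      (fun r _ => (hd r).continuousAt.continuousWithinAt) (fun r _ => hd r)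
    refine ⟨ξ, Ioo_subset_Icc_self hξ, ?_⟩
    have : S₁ ξ ≠ 0 := hne ξ ⟨by linarith [ha.1, hξ.1], by linarith [hb.2, hξ.2]⟩
    refine mul_right_cancel₀ this ?_
    rw [e]
    ring
  refine ⟨fun s => S₁ (ρ s) ^ 2 / 2, ?_, fun s hs => ⟨by positivity, ?_⟩⟩
  · have : ρ (S 0) = 0 := hinj (hρ _ left_mem_uIcc) h0r (hSρ _ left_mem_uIcc)
    simp [this, h0]
  · have e : F s (S₁ (ρ s) ^ 2 / 2) = S₂ (ρ s) := by
      rw [← hF _ (hρ s hs), hSρ s hs]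
    change HasDerivWithinAt _ (F s (S₁ (ρ s) ^ 2 / 2)) U s
    rw [e, hasDerivWithinAt_iff_tendsto_slope]
    have hξ : ∀ x ∈ U \ {s}, ∃ ξ, min (ρ s) (ρ x) ≤ ξ ∧ ξ ≤ max (ρ s) (ρ x) ∧
        slope (fun s => S₁ (ρ s) ^ 2 / 2) s x = S₂ ξ := by
      rintro x ⟨hx, hxs⟩
      have hxs' : x - s ≠ 0 := sub_ne_zero.2 hxs
      have hne : ρ s ≠ ρ x := fun h => hxs (by
        rw [mem_singleton_iff, ← hSρ x hx, ← h, hSρ s hs])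
      rcases lt_or_gt_of_ne hne with h | h
      · obtain ⟨ξ, h1, h2⟩ := hmvt _ _ (hρ s hs) (hρ x hx) h
        refine ⟨ξ, (min_le_left _ _).trans h1.1, h1.2.trans (le_max_right _ _), ?_⟩
        rw [hSρ s hs, hSρ x hx] at h2
        rw [slope_def_field, h2]
        field_simp
      · obtain ⟨ξ, h1, h2⟩ := hmvt _ _ (hρ x hx) (hρ s hs) h
        refine ⟨ξ, (min_le_right _ _).trans h1.1, h1.2.trans (le_max_left _ _), ?_⟩
        rw [hSρ s hs, hSρ x hx] at h2
        rw [slope_def_field, div_eq_iff hxs']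
        linear_combination -h2
    choose! ξ h1 h2 h3 using hξ
    have tρ : Tendsto ρ (𝓝[U \ {s}] s) (𝓝 (ρ s)) :=
      (cρ s hs).tendsto.mono_left (nhdsWithin_mono _ sdiff_subset)
    have tξ : Tendsto ξ (𝓝[U \ {s}] s) (𝓝 (ρ s)) := by
      have ta : Tendsto (fun x => min (ρ s) (ρ x)) (𝓝[U \ {s}] s) (𝓝 (ρ s)) := by
        simpa using (tendsto_const_nhds (x := ρ s)).min tρ
      have tb : Tendsto (fun x => max (ρ s) (ρ x)) (𝓝[U \ {s}] s) (𝓝 (ρ s)) := by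
        simpa using (tendsto_const_nhds (x := ρ s)).max tρ
      exact tendsto_of_tendsto_of_tendsto_of_le_of_le' ta tb
        (eventually_nhdsWithin_of_forall h1) (eventually_nhdsWithin_of_forall h2)
    exact ((hS₂.tendsto _).comp tξ).congr'
      (eventually_nhdsWithin_of_forall fun x hx => (h3 x hx).symm)

/-- Solutions of `dy/ds = F(s, y)` are unique along an orbit starting at rest, when `F(s, ·)` is
Lipschitz as a function of `√(2y)`. -/
theorem SolvesOn.eq_orbit {F : ℝ → ℝ → ℝ} {S S₁ S₂ f : ℝ → ℝ} {r₀ ν : ℝ} (hr : 0 ≤ r₀)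
    (hν : 0 ≤ ν) (hS : ∀ r, HasDerivAt S (S₁ r) r) (hS₁ : ∀ r, HasDerivAt S₁ (S₂ r) r)
    (h0 : S₁ 0 = 0) (hmaps : MapsTo S (Icc 0 r₀) (uIcc (S 0) (S r₀)))
    (hF : ∀ r ∈ Icc 0 r₀, F (S r) (S₁ r ^ 2 / 2) = S₂ r)
    (hLip : ∀ s y z, |F s y - F s z| ≤ ν * |√(2 * y) - √(2 * z)|)
    (hf : SolvesOn F (S 0) (S r₀) f) : f (S r₀) = S₁ r₀ ^ 2 / 2 := by
  have hd : ∀ r ∈ Icc 0 r₀, HasDerivWithinAt (fun r => S₁ r ^ 2 / 2 - f (S r))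
      (S₁ r * (S₂ r - F (S r) (f (S r)))) (Icc 0 r₀) r := by
    intro r hr'
    have h1 := ((hf.2 _ (hmaps hr')).2).comp r (hS r).hasDerivWithinAt hmaps
    have h2 := (((hS₁ r).pow 2).div_const 2).hasDerivWithinAt (s := Icc 0 r₀)
    refine (h2.sub h1).congr_deriv ?_
    simp
    ring
  -- In the variable `s` the field is not Lipschitz at `y = 0`. Pulling back along the orbit
  -- supplies a factor `S₁`, and `|S₁| * ||S₁| - g| ≤ (|S₁| + g) * ||S₁| - g| = 2 * |S₁²/2 - f|`
  -- with `g = √(2f)`, so Grönwall applies with constant `2ν`.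
  have := eq_zero_of_abs_deriv_le_mul_abs_self_of_eq_zero_right
    (f := fun r => S₁ r ^ 2 / 2 - f (S r)) (f' := fun r => S₁ r * (S₂ r - F (S r) (f (S r))))
    (K := 2 * ν) (a := 0) (b := r₀) (fun r h => (hd r h).continuousWithinAt)
    (fun r h => (hd r (Ico_subset_Icc_self h)).mono_of_mem_nhdsWithin
      (mem_of_superset (Icc_mem_nhdsGE h.2) (Icc_subset_Icc_left h.1)))
    (by simp [h0, hf.1]) ?_ r₀ (right_mem_Icc.2 hr)
  · linarith
  · intro r h
    have h' := Ico_subset_Icc_self h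
    have hfn := (hf.2 _ (hmaps h')).1
    set g := √(2 * f (S r)) with hg
    have hg0 : 0 ≤ g := Real.sqrt_nonneg _
    have hg2 : g ^ 2 = 2 * f (S r) := Real.sq_sqrt (by linarith)
    have hl := hLip (S r) (S₁ r ^ 2 / 2) (f (S r))
    rw [hF r h', mul_div_cancel₀ _ (two_ne_zero' ℝ), Real.sqrt_sq_eq_abs, ← hg] at hl
    have e : S₁ r ^ 2 / 2 - f (S r) = (|S₁ r| + g) * (|S₁ r| - g) / 2 := by
      rw [← sq_abs]
      linear_combination hg2 / 2
    rw [Real.norm_eq_abs, Real.norm_eq_abs, abs_mul, e, abs_div, abs_mul, abs_two,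
      abs_of_nonneg (add_nonneg (abs_nonneg (S₁ r)) hg0)]
    calc |S₁ r| * |S₂ r - F (S r) (f (S r))| ≤ |S₁ r| * (ν * |(|S₁ r|) - g|) :=
          mul_le_mul_of_nonneg_left hl (abs_nonneg _)
      _ ≤ (|S₁ r| + g) * (ν * |(|S₁ r|) - g|) :=
          mul_le_mul_of_nonneg_right (by linarith) (by positivity)
      _ = _ := by ring

theorem maxSol_spec {F : ℝ → ℝ → ℝ} {a s : ℝ} (h : s ∈ solDom F a) :
    ∃ f, SolvesOn F a s f ∧ maxSol F a s = f s :=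
  ⟨h.choose, h.choose_spec, by simp [maxSol, h]⟩

namespace IsImpulse

variable {ν c : ℝ} {G G' : ℝ → ℝ}

theorem nonneg_of_pos (h : IsImpulse ν c G G') {L r : ℝ} (hG : ∀ t ∈ Ioo 0 L, 0 < G t)
    (hL : 0 ≤ G L) (hr : r ≤ L) :
    ∀ t ∈ Icc 0 r, 0 ≤ G t := by
  intro t ht
  rcases eq_or_lt_of_le ht.1 with h0 | h0
  · rw [← h0, h.zero]
  · rcases eq_or_lt_of_le (ht.2.trans hr) with h1 | h1
    · rwa [h1]
    · exact (hG t ⟨h0, h1⟩).le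

theorem strictMonoOn_backStep (h : IsImpulse ν c G G') (hc : c ≠ 0) {L : ℝ}
    (hG : ∀ t ∈ Ioo 0 L, 0 < G t) : StrictMonoOn (backStep ν c G') (Icc 0 L) := by
  refine strictMonoOn_of_hasDerivWithinAt_pos (convex_Icc _ _)
    (fun t _ => (h.hasDerivAt_backStep hc t).continuousAt.continuousWithinAt)
    (fun t _ => (h.hasDerivAt_backStep hc t).hasDerivWithinAt) ?_
  intro t ht
  rw [interior_Icc] at ht
  exact mul_pos (Real.exp_pos _) (hG t ht)

/-- The backward orbit of the rest point `(a, 0)` is the orbit of the origin scaled by `1 - c * a`.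
The sign of this factor decides the branch of the square root: `a = 0` gives `P`, while `1 - c * a <
0` gives `N`, the minus sign in `fieldN` being absorbed by the negative velocity. -/
theorem maxSol_orbit (h : IsImpulse ν c G G') (hν : 0 ≤ ν) (hc : c ≠ 0) {L r a : ℝ}
    {F : ℝ → ℝ → ℝ} (hG : ∀ t ∈ Ioo 0 L, 0 < G t) (hr : r ∈ Ioo 0 L) (ha : 1 - c * a ≠ 0)
    (hF : ∀ s, ∀ q, 0 ≤ q → F s (((1 - c * a) * q) ^ 2 / 2) = ν * ((1 - c * a) * q) + 1 - c * s)
    (hLip : ∀ s y z, |F s y - F s z| ≤ ν * |√(2 * y) - √(2 * z)|) :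
    a + (1 - c * a) * backStep ν c G' r ∈ solDom F a ∧
    maxSol F a (a + (1 - c * a) * backStep ν c G' r)
      = ((1 - c * a) * (Real.exp (ν * r) * G r)) ^ 2 / 2 := by
  have hmono := (h.strictMonoOn_backStep hc hG).mono (Icc_subset_Icc_right hr.2.le)
  set S : ℝ → ℝ := fun r => a + (1 - c * a) * backStep ν c G' r with hSdef
  set S₁ : ℝ → ℝ := fun r => (1 - c * a) * (Real.exp (ν * r) * G r) with hS₁def
  have hS : ∀ r, HasDerivAt S (S₁ r) r := fun r =>
    ((h.hasDerivAt_backStep hc r).const_mul _).const_add a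
  have hS₁ : ∀ r, HasDerivAt S₁ (ν * S₁ r + 1 - c * S r) r := fun r => by
    refine ((h.hasDerivAt_exp_mul hc r).const_mul _).congr_deriv ?_
    simp only [hSdef, hS₁def]
    ring
  have cS : Continuous S := continuous_iff_continuousAt.2 fun t => (hS t).continuousAt
  have cS₁ : Continuous S₁ := continuous_iff_continuousAt.2 fun t => (hS₁ t).continuousAt
  have hS0 : S 0 = a := by simp [hSdef, h.backStep_zero]
  have h0 : S₁ 0 = 0 := by simp [hS₁def, h.zero]
  have hGr : ∀ t ∈ Icc 0 r, 0 ≤ G t :=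
    h.nonneg_of_pos (fun t ht => hG t ⟨ht.1, ht.2.trans hr.2⟩) (hG r hr).le le_rfl
  have hF' : ∀ t ∈ Icc 0 r, F (S t) (S₁ t ^ 2 / 2) = ν * S₁ t + 1 - c * S t := fun t ht =>
    hF _ _ (mul_nonneg (Real.exp_pos _).le (hGr t ht))
  have hinj : InjOn S (Icc 0 r) := fun x hx y hy hxy =>
    hmono.injOn hx hy (mul_left_cancel₀ ha (add_left_cancel hxy))
  have hmaps : MapsTo S (Icc 0 r) (uIcc (S 0) (S r)) := by
    intro t ht
    have h1 := hmono.monotoneOn (left_mem_Icc.2 hr.1.le) ht ht.1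
    have h2 := hmono.monotoneOn ht (right_mem_Icc.2 hr.1.le) ht.2
    rcases le_total 0 (1 - c * a) with hm | hm
    · exact Icc_subset_uIcc ⟨by simpa [hSdef] using mul_le_mul_of_nonneg_left h1 hm,
        by simpa [hSdef] using mul_le_mul_of_nonneg_left h2 hm⟩
    · exact Icc_subset_uIcc' ⟨by simpa [hSdef] using mul_le_mul_of_nonpos_left h2 hm,
        by simpa [hSdef] using mul_le_mul_of_nonpos_left h1 hm⟩
  have hdom : S r ∈ solDom F a := by
    have := mem_solDom_of_orbit (F := F) hr.1.le hS hS₁ (by fun_prop) h0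
      (fun t ht => mul_ne_zero ha (mul_pos (Real.exp_pos _)
        (hG t ⟨ht.1, ht.2.trans hr.2⟩)).ne') hinj hF'
    rwa [hS0] at this
  refine ⟨hdom, ?_⟩
  obtain ⟨f, hf, e⟩ := maxSol_spec hdom
  change maxSol F a (S r) = S₁ r ^ 2 / 2
  rw [e]
  rw [← hS0] at hf
  exact hf.eq_orbit hr.1.le hν hS hS₁ h0 hmaps hF' hLip

theorem P_backStep (h : IsImpulse ν c G G') (hν : 0 ≤ ν) (hc : c ≠ 0) {L r : ℝ}
    (hG : ∀ t ∈ Ioo 0 L, 0 < G t) (hr : r ∈ Ioo 0 L) :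
    backStep ν c G' r ∈ domP ν c ∧
    √(2 * P ν c (backStep ν c G' r)) = Real.exp (ν * r) * G r := by
  have := h.maxSol_orbit (a := 0) (F := fieldP ν c) hν hc hG hr (by simp) ?_ ?_
  · simp only [mul_zero, sub_zero, one_mul, zero_add] at this
    refine ⟨this.1, ?_⟩
    rw [P, this.2, mul_div_cancel₀ _ (two_ne_zero' ℝ),
      Real.sqrt_sq (mul_nonneg (Real.exp_pos _).le (hG r hr).le)]
  · intro s q hq
    simp [fieldP, mul_div_cancel₀ _ (two_ne_zero' ℝ), Real.sqrt_sq hq]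
  · intro s y z
    have : fieldP ν c s y - fieldP ν c s z = ν * (√(2 * y) - √(2 * z)) := by
      unfold fieldP; ring
    rw [this, abs_mul, abs_of_nonneg hν]

theorem N_backStep (h : IsImpulse ν c G G') (hν : 0 ≤ ν) (hc : c ≠ 0) {L r a : ℝ}
    (hG : ∀ t ∈ Ioo 0 L, 0 < G t) (hr : r ∈ Ioo 0 L) (ha : 1 - c * a < 0) :
    a + (1 - c * a) * backStep ν c G' r ∈ domN ν c a ∧
    √(2 * N ν c a (a + (1 - c * a) * backStep ν c G' r))
      = (c * a - 1) * (Real.exp (ν * r) * G r) := by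
  have := h.maxSol_orbit (a := a) (F := fieldN ν c) hν hc hG hr ha.ne ?_ ?_
  · refine ⟨this.1, ?_⟩
    rw [N, this.2, mul_div_cancel₀ _ (two_ne_zero' ℝ), Real.sqrt_sq_eq_abs, abs_mul,
      abs_of_neg ha, abs_of_nonneg (mul_nonneg (Real.exp_pos _).le (hG r hr).le)]
    ring
  · intro s q hq
    rw [fieldN, mul_div_cancel₀ _ (two_ne_zero' ℝ), Real.sqrt_sq_eq_abs, abs_mul,
      abs_of_neg ha, abs_of_nonneg hq]
    ring
  · intro s y z
    have : fieldN ν c s y - fieldN ν c s z = -(ν * (√(2 * y) - √(2 * z))) := by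
      unfold fieldN; ring
    rw [this, abs_neg, abs_mul, abs_of_nonneg hν]

end IsImpulse

theorem sTilde_mul {ν c : ℝ} (hc : c ≠ 0) :
    c * sTilde ν c = 1 + Real.exp (Real.pi * ν / √(4 * c - ν ^ 2)) := by
  unfold sTilde; field_simp

/-- In the underdamped case `G` also vanishes at this time, so `sTilde` is the point where the
backward orbit of the origin next comes to rest. -/
theorem backStep_halfPeriod {ν c : ℝ} {G' : ℝ → ℝ}
    (hG' : G' (2 * Real.pi / √(4 * c - ν ^ 2)) = -Real.exp (-(Real.pi * ν / √(4 * c - ν ^ 2)))) :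
    backStep ν c G' (2 * Real.pi / √(4 * c - ν ^ 2)) = sTilde ν c := by
  have : ν * (2 * Real.pi / √(4 * c - ν ^ 2)) + -(Real.pi * ν / √(4 * c - ν ^ 2))
      = Real.pi * ν / √(4 * c - ν ^ 2) := by ring
  rw [backStep, sTilde, hG', mul_neg, ← Real.exp_add, this]
  ring

/-! ### Breakdown of trajectories -/

namespace IsImpulse

variable {ν c b : ℝ} {G G' κ s p : ℝ → ℝ}

/-- A trajectory starting on or below the curve `p = -√(2P(s))` reaches zero. -/
theorem lt_of_le_backStep (h : IsImpulse ν c G G') (hc : c ≠ 0) (hs : IsTrajectory ν b κ s p)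
    (hκ : ∀ t ∈ Ioo 0 b, c ≤ κ t) {r : ℝ} (hr : 0 ≤ r)
    (hG : ∀ t ∈ Icc 0 r, 0 ≤ G t) (h0 : s 0 = backStep ν c G' r)
    (hp : p 0 ≤ -(Real.exp (ν * r) * G r)) : b < r := by
  by_contra! hb
  have h1 := h.trajectory_le hc hs hκ le_rfl hr (by linarith) hG
  rw [zero_add, h0] at h1
  have h2 := h.backStep_return hc r
  have h3 := mul_le_mul_of_nonneg_right hp (hG r ⟨hr, le_rfl⟩)
  linarith [hs.pos r ⟨hr, hb⟩]

/-- Once `s` exceeds the threshold, it reaches zero within a half-period of the oscillator. -/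
theorem lt_of_sTilde_le (h : IsImpulse ν c G G') (hc : 0 < c) (hs : IsTrajectory ν b κ s p)
    (hκ : ∀ t ∈ Ioo 0 b, c ≤ κ t) {t₀ L : ℝ}    (ht : 0 ≤ t₀) (hL : 0 ≤ L) (hG : ∀ t ∈ Icc 0 L, 0 ≤ G t) (hGL : G L = 0)
    (hGL' : G' L = -Real.exp (-(Real.pi * ν / √(4 * c - ν ^ 2))))
    (h0 : sTilde ν c ≤ s t₀) : b < t₀ + L := by
  by_contra! hb
  have h1 := h.trajectory_le hc.ne' hs hκ ht hL hb hG
  have h3 := mul_le_mul_of_nonneg_left h0 hc.le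
  rw [sTilde_mul hc.ne'] at h3
  have hee : Real.exp (-(Real.pi * ν / √(4 * c - ν ^ 2)))
      * Real.exp (Real.pi * ν / √(4 * c - ν ^ 2)) = 1 := by
    rw [← Real.exp_add]; simp
  set e' := Real.exp (-(Real.pi * ν / √(4 * c - ν ^ 2)))
  set e := Real.exp (Real.pi * ν / √(4 * c - ν ^ 2))
  have he' : 0 < e' := Real.exp_pos _
  have hst : c * step ν c G G' L = 1 + e' := by
    unfold step; rw [hGL, hGL']; field_simp; ring
  -- As `G L = 0`, the unknown velocity `p t₀` drops out. With `e' * e = 1`, the remaining bound on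
  -- `c * s (t₀ + L)` is `1 + e' - e' * (c * s t₀)`, which is nonpositive once `c * s t₀ ≥ 1 + e`.
  rw [hGL] at h1
  have h4 : c * s (t₀ + L) ≤ c * s t₀ + (1 - c * s t₀) * (c * step ν c G G' L) := by
    have := mul_le_mul_of_nonneg_left h1 hc.le
    linarith
  rw [hst] at h4
  have h5 : 0 < c * s (t₀ + L) := mul_pos hc (hs.pos _ ⟨by linarith, hb⟩)
  nlinarith

end IsImpulse

/-- Violating the threshold condition forces every trajectory to break down before a time that
depends on the data only. -/
theorem exists_breakdown_time {ν cm cp s₀ p₀ : ℝ} (hν : 0 ≤ ν) (hcm : 0 < cm) (hcmp : cm ≤ cp)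
    (hs₀ : 0 < s₀)
    (hviol : ¬ ((s₀ ∈ domP ν cm ∧ -√(2 * P ν cm s₀) < p₀) ∧
      (ν < 2 * √cm → s₀ ∈ domN ν cp (sTilde ν cm) ∧ p₀ < √(2 * N ν cp (sTilde ν cm) s₀)))) :
    ∃ Tstar, 0 < Tstar ∧ ∀ b κ s p, IsTrajectory ν b κ s p →
      (∀ t ∈ Ioo 0 b, cm ≤ κ t ∧ κ t ≤ cp) → s 0 = s₀ → p 0 = p₀ → b < Tstar := by
  rcases le_or_gt (2 * √cm) ν with hd | hd
  · have h4 : 4 * cm ≤ ν ^ 2 := by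
      have := pow_le_pow_left₀ (by positivity) hd 2
      rwa [mul_pow, Real.sq_sqrt hcm.le, show (2 : ℝ) ^ 2 = 4 by norm_num] at this
    obtain ⟨G, G', hI, hGt⟩ := exists_isImpulse_overdamped h4
    have hGpos : ∀ t, 0 < t → 0 < G t := fun t ht =>
      (mul_pos (Real.exp_pos _) ht).trans_le (hGt t ht.le)
    -- Quadratic growth makes the backward orbit pass over every `s₀ > 0`, so `P` is defined at
    -- `s₀`; the time `1 + s₀` suffices because `(1 + s₀)²/2 ≥ s₀`.
    have hgrow : ∀ t, 0 ≤ t → t ^ 2 / 2 ≤ backStep ν cm G' t := by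
      intro t ht
      have hm : MonotoneOn (fun t => backStep ν cm G' t - t ^ 2 / 2) (Ici 0) := by
        have hdv : ∀ t, HasDerivAt (fun t => backStep ν cm G' t - t ^ 2 / 2)
            (Real.exp (ν * t) * G t - t) t := fun t => by
          refine ((hI.hasDerivAt_backStep hcm.ne' t).sub
            (((hasDerivAt_id t).pow 2).div_const 2)).congr_deriv ?_
          simp
        refine monotoneOn_of_hasDerivWithinAt_nonneg (convex_Ici _)
          (fun t _ => (hdv t).continuousAt.continuousWithinAt)
          (fun t _ => (hdv t).hasDerivWithinAt) ?_
        intro t ht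
        rw [interior_Ici] at ht
        have ht : 0 < t := ht
        have h1 : 1 ≤ Real.exp (ν * t) * Real.exp (-(ν / 2) * t) := by
          rw [← Real.exp_add]
          refine Real.one_le_exp ?_
          have := mul_nonneg hν ht.le
          linarith
        have h2 := mul_le_mul_of_nonneg_left (hGt t ht.le) (Real.exp_pos (ν * t)).le
        have h3 := mul_le_mul_of_nonneg_right h1 ht.le
        linarith
      have := hm (self_mem_Ici (a := (0 : ℝ))) ht ht
      simp only [hI.backStep_zero] at this
      linarith
    have hcont : Continuous (backStep ν cm G') :=
      continuous_iff_continuousAt.2 fun t => (hI.hasDerivAt_backStep hcm.ne' t).continuousAt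
    obtain ⟨r, hr, hrs⟩ : ∃ r ∈ Icc 0 (1 + s₀), backStep ν cm G' r = s₀ := by
      refine intermediate_value_Icc (by linarith) hcont.continuousOn ⟨?_, ?_⟩
      · rw [hI.backStep_zero]; exact hs₀.le
      · refine le_trans ?_ (hgrow _ (by linarith))
        nlinarith
    have hr0 : 0 < r := by
      rcases eq_or_lt_of_le hr.1 with h | h
      · rw [← h, hI.backStep_zero] at hrs
        exact absurd hrs hs₀.ne
      · exact h
    have hP := hI.P_backStep hν hcm.ne' (L := r + 1) (r := r) (fun t ht => hGpos t ht.1)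
      ⟨hr0, by linarith⟩
    rw [hrs] at hP
    have hp : p₀ ≤ -(Real.exp (ν * r) * G r) := by
      rw [← hP.2]
      by_contra! hlt
      exact hviol ⟨⟨hP.1, hlt⟩, fun h => absurd h hd.not_gt⟩
    refine ⟨r, hr0, fun b κ s p hs hκ e1 e2 => ?_⟩
    refine hI.lt_of_le_backStep hcm.ne' hs (fun t ht => (hκ t ht).1) hr0.le ?_ (e1.trans hrs.symm)
      (e2 ▸ hp)
    exact hI.nonneg_of_pos (fun t ht => hGpos t ht.1) (hGpos r hr0).le le_rfl
  · have h4 : ν ^ 2 < 4 * cm := by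
      have := pow_lt_pow_left₀ hd hν two_ne_zero
      rwa [mul_pow, Real.sq_sqrt hcm.le, show (2 : ℝ) ^ 2 = 4 by norm_num] at this
    have h4p : ν ^ 2 < 4 * cp := by linarith
    have hcp : 0 < cp := hcm.trans_le hcmp
    obtain ⟨G, G', hI, hGpos, hGL, hGL'⟩ := exists_isImpulse_underdamped h4
    obtain ⟨H, H', hJ, hHpos, hHL, hHL'⟩ := exists_isImpulse_underdamped h4p
    have hRL := backStep_halfPeriod hGL'
    have hRM := backStep_halfPeriod hHL'
    have hLpos : 0 < 2 * Real.pi / √(4 * cm - ν ^ 2) :=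
      div_pos (by positivity) (Real.sqrt_pos.2 (by linarith))
    have hMpos : 0 < 2 * Real.pi / √(4 * cp - ν ^ 2) :=
      div_pos (by positivity) (Real.sqrt_pos.2 (by linarith))
    set L := 2 * Real.pi / √(4 * cm - ν ^ 2) with hL
    set M := 2 * Real.pi / √(4 * cp - ν ^ 2) with hM
    have hGL0 := hI.nonneg_of_pos hGpos hGL.ge le_rfl
    rcases le_or_gt (sTilde ν cm) s₀ with hbig | hsmall
    · refine ⟨L, hLpos, fun b κ s p hs hκ e1 e2 => ?_⟩
      have := hI.lt_of_sTilde_le hcm hs (fun t ht => (hκ t ht).1) le_rfl hLpos.le hGL0 hGL hGL'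
        (e1 ▸ hbig)
      simpa using this
    · have hcont : Continuous (backStep ν cm G') :=
        continuous_iff_continuousAt.2 fun t => (hI.hasDerivAt_backStep hcm.ne' t).continuousAt
      have hcontH : Continuous (backStep ν cp H') :=
        continuous_iff_continuousAt.2 fun t => (hJ.hasDerivAt_backStep hcp.ne' t).continuousAt
      obtain ⟨r, hr, hrs⟩ : ∃ r ∈ Ioo 0 L, backStep ν cm G' r = s₀ :=
        intermediate_value_Ioo hLpos.le hcont.continuousOn
          ⟨by rwa [hI.backStep_zero], by rwa [hRL]⟩
      have hP := hI.P_backStep hν hcm.ne' hGpos hr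
      rw [hrs] at hP
      set a := sTilde ν cm with ha
      have hca : cm * a = 1 + Real.exp (Real.pi * ν / √(4 * cm - ν ^ 2)) := sTilde_mul hcm.ne'
      have hexp : 1 ≤ Real.exp (Real.pi * ν / √(4 * cm - ν ^ 2)) :=
        Real.one_le_exp (by positivity)
      have ha0 : 0 < a := lt_trans hs₀ hsmall
      have hcpa : cm * a ≤ cp * a := mul_le_mul_of_nonneg_right hcmp ha0.le
      have hma : 1 - cp * a < 0 := by linarith
      -- After half a `cp`-period the backward orbit of `(a, 0)` has reached `s ≤ 0`, because `cp *
      -- a ≥ 2` and the exponential for `cp` is at least `1`. Hence `N` is defined at every `s₀` in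
      -- `(0, a)`.
      have hendpt : a + (1 - cp * a) * sTilde ν cp ≤ 0 := by
        have h1 := sTilde_mul (ν := ν) hcp.ne'
        have h2 : 1 ≤ Real.exp (Real.pi * ν / √(4 * cp - ν ^ 2)) :=
          Real.one_le_exp (by positivity)
        have h3 : cp * (a + (1 - cp * a) * sTilde ν cp) ≤ 0 := by
          have : cp * (a + (1 - cp * a) * sTilde ν cp)
              = cp * a + (1 - cp * a) * (cp * sTilde ν cp) := by ring
          rw [this, h1]
          nlinarith
        by_contra! hlt
        exact absurd h3 (mul_pos hcp hlt).not_ge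
      obtain ⟨q, hq, hqs⟩ : ∃ q ∈ Ioo 0 M, a + (1 - cp * a) * backStep ν cp H' q = s₀ := by
        have := intermediate_value_Ioo' (f := fun q => a + (1 - cp * a) * backStep ν cp H' q)
          hMpos.le (by fun_prop)
        refine this ⟨?_, ?_⟩
        · simp only [hRM]; linarith
        · simpa only [hJ.backStep_zero, mul_zero, add_zero]
      have hN := hJ.N_backStep hν hcp.ne' hHpos hq hma
      rw [hqs] at hN
      by_cases hp : p₀ ≤ -(Real.exp (ν * r) * G r)
      · refine ⟨r, hr.1, fun b κ s p hs hκ e1 e2 => ?_⟩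
        exact hI.lt_of_le_backStep hcm.ne' hs (fun t ht => (hκ t ht).1) hr.1.le
          (hI.nonneg_of_pos hGpos hGL.ge hr.2.le) (e1.trans hrs.symm) (e2 ▸ hp)
      · have hp' : (cp * a - 1) * (Real.exp (ν * q) * H q) ≤ p₀ := by
          rw [← hN.2]
          by_contra! hlt
          exact hviol ⟨⟨hP.1, by rw [hP.2]; exact not_le.1 hp⟩, fun _ => ⟨hN.1, hlt⟩⟩
        have hHq := hJ.nonneg_of_pos hHpos hHL.ge hq.2.le
        -- Time `q` lifts `s` to the threshold `a`; a further half-period `L` brings it down to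
        -- zero.
        refine ⟨q + L, add_pos hq.1 hLpos, fun b κ s p hs hκ e1 e2 => ?_⟩
        rcases lt_or_ge b q with hb | hb
        · linarith
        have h1 := hJ.le_trajectory hcp.ne' hs (fun t ht => (hκ t ht).2) hq.1.le hb hHq
        have h2 := hJ.backStep_return hcp.ne' q
        have h3 := mul_le_mul_of_nonneg_right hp' (hHq q ⟨hq.1.le, le_rfl⟩)
        rw [e1, e2, ← hqs] at h1
        have h5 : a ≤ s q := by
          refine le_trans ?_ h1
          have : a + (1 - cp * a) * backStep ν cp H' q
              + (cp * a - 1) * (Real.exp (ν * q) * H q) * H q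
              + (1 - cp * (a + (1 - cp * a) * backStep ν cp H' q)) * step ν cp H H' q = a := by
            linear_combination (1 - cp * a) * h2
          linarith
        exact hI.lt_of_sTilde_le hcm hs (fun t ht => (hκ t ht).1) hq.1.le hLpos.le hGL0 hGL hGL'
          h5

/-! ### From the PDE to the oscillator along characteristics -/

/-- Pointwise limits of functions with dominated derivatives may be differentiated. -/
theorem hasDerivAt_of_dominated {a b B : ℝ} {g I : ℝ → ℝ → ℝ} {d I₀ : ℝ → ℝ}
    (hg : ∀ h ≠ 0, ∀ t ∈ Ioo a b, HasDerivAt (g h) (I h t) t)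
    (hI : ∀ h ≠ 0, ContinuousOn (I h) (Ioo a b))
    (hB : ∀ h ≠ 0, ∀ t ∈ Ioo a b, |I h t| ≤ B)
    (hgd : ∀ t ∈ Ioo a b, Tendsto (fun h => g h t) (𝓝[≠] 0) (𝓝 (d t)))
    (hII : ∀ t ∈ Ioo a b, Tendsto (fun h => I h t) (𝓝[≠] 0) (𝓝 (I₀ t)))
    (hI₀ : ContinuousOn I₀ (Ioo a b)) {t : ℝ} (ht : t ∈ Ioo a b) :
    HasDerivAt d (I₀ t) t := by
  have hne : ∀ᶠ h : ℝ in 𝓝[≠] 0, h ≠ 0 := eventually_mem_nhdsWithin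
  have key : ∀ τ ∈ Ioo a b, ∫ x in t..τ, I₀ x = d τ - d t := by
    intro τ hτ
    have hsub : uIcc t τ ⊆ Ioo a b := ordConnected_Ioo.uIcc_subset ht hτ
    have hsub' : uIoc t τ ⊆ Ioo a b := uIoc_subset_uIcc.trans hsub
    refine tendsto_nhds_unique (f := fun h => ∫ x in t..τ, I h x) (l := 𝓝[≠] (0 : ℝ)) ?_ ?_
    · refine intervalIntegral.tendsto_integral_filter_of_dominated_convergence (fun _ => B)
        ?_ ?_ (by simp) ?_
      · filter_upwards [hne] with h hh
        exact ((hI h hh).mono hsub').aestronglyMeasurable measurableSet_uIoc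
      · filter_upwards [hne] with h hh
        exact MeasureTheory.ae_of_all _ fun x hx => hB h hh x (hsub' hx)
      · exact MeasureTheory.ae_of_all _ fun x hx => hII x (hsub' hx)
    · refine ((hgd τ hτ).sub (hgd t ht)).congr' ?_
      filter_upwards [hne] with h hh
      exact (intervalIntegral.integral_eq_sub_of_hasDerivAt (fun x hx => hg h hh x (hsub hx))
        ((hI h hh).mono hsub).intervalIntegrable).symm
  have hnhds : Ioo a b ∈ 𝓝 t := isOpen_Ioo.mem_nhds ht
  have hD : HasDerivAt (fun τ => d t + ∫ x in t..τ, I₀ x) (I₀ t) t :=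
    (intervalIntegral.integral_hasDerivAt_right (by simp)
      (hI₀.stronglyMeasurableAtFilter isOpen_Ioo t ht) (hI₀.continuousAt hnhds)).const_add _
  refine hD.congr_of_eventuallyEq ?_
  filter_upwards [hnhds] with τ hτ
  rw [key τ hτ]
  ring

theorem abs_sub_div_le {f f' : ℝ → ℝ} {M : ℝ} (hf : ∀ y, HasDerivAt f (f' y) y)
    (hM : ∀ y, |f' y| ≤ M) (x h : ℝ) : |(f (x + h) - f x) / h| ≤ M := by
  have h0 : 0 ≤ M := (abs_nonneg _).trans (hM x)
  have := convex_univ.norm_image_sub_le_of_norm_hasDerivWithin_le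
    (fun y _ => (hf y).hasDerivWithinAt) (fun y _ => hM y) (mem_univ x) (mem_univ (x + h))
  rw [abs_div]
  refine div_le_of_le_mul₀ (abs_nonneg _) h0 ?_
  simpa using this

theorem tendsto_sub_div {f : ℝ → ℝ} {f' x : ℝ} (hf : HasDerivAt f f' x) :
    Tendsto (fun h => (f (x + h) - f x) / h) (𝓝[≠] 0) (𝓝 f') := by
  refine (hasDerivAt_iff_tendsto_slope_zero.1 hf).congr fun h => ?_
  rw [smul_eq_mul, div_eq_inv_mul]

/-- Continuous partial derivatives of a function of class `C¹` on `[0,T) × ℝ`, with the chain rule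
along curves. -/
theorem IsClassC1.exists_partials {T : ℝ} {f : ℝ → ℝ → ℝ} (hf : IsClassC1 T f) :
    ∃ ft fx : ℝ → ℝ → ℝ,
      ContinuousOn (Function.uncurry ft) (Ico 0 T ×ˢ univ) ∧
      ContinuousOn (Function.uncurry fx) (Ico 0 T ×ˢ univ) ∧
      (∀ t ∈ Ico 0 T, ∀ x, HasDerivAt (f t) (fx t x) x) ∧
      ∀ t ∈ Ioo 0 T, ∀ (X : ℝ → ℝ) (X' : ℝ), HasDerivAt X X' t →
        HasDerivAt (fun τ => f τ (X τ)) (ft t (X t) + fx t (X t) * X') t := by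
  rcases le_or_gt T 0 with hT | hT
  · exact ⟨0, 0, continuousOn_const, continuousOn_const,
      fun t ht => absurd (ht.1.trans_lt ht.2) hT.not_gt,
      fun t ht => absurd (ht.1.trans ht.2) hT.not_gt⟩
  set Ω : Set (ℝ × ℝ) := Ico 0 T ×ˢ univ
  have hud : UniqueDiffOn ℝ Ω := (uniqueDiffOn_Ico 0 T).prod uniqueDiffOn_univ
  set D := fderivWithin ℝ (Function.uncurry f) Ω
  have hD : ContinuousOn D Ω := hf.1.continuousOn_fderivWithin hud le_rfl
  have hdiff : ∀ z ∈ Ω, HasFDerivWithinAt (Function.uncurry f) (D z) Ω z := fun z hz =>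
    ((hf.1.differentiableOn one_ne_zero) z hz).hasFDerivWithinAt
  refine ⟨fun t x => D (t, x) (1, 0), fun t x => D (t, x) (0, 1), ?_, ?_, ?_, ?_⟩
  · exact hD.clm_apply continuousOn_const
  · exact hD.clm_apply continuousOn_const
  · intro t ht x
    have h1 : HasDerivAt (fun y : ℝ => (t, y)) ((0 : ℝ), (1 : ℝ)) x :=
      (hasDerivAt_const x t).prodMk (hasDerivAt_id x)
    have := (hdiff (t, x) ⟨ht, mem_univ _⟩).comp_hasDerivWithinAt (s := univ) x
      h1.hasDerivWithinAt (fun y _ => ⟨ht, mem_univ _⟩)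
    exact hasDerivWithinAt_univ.1 this
  · intro t ht X X' hX
    have hnhds : Ω ∈ 𝓝 (t, X t) := prod_mem_nhds (Ico_mem_nhds ht.1 ht.2) univ_mem
    have h1 : HasDerivAt (fun τ : ℝ => (τ, X τ)) ((1 : ℝ), X') t :=
      (hasDerivAt_id t).prodMk hX
    have h2 := (hdiff (t, X t) (mem_of_mem_nhds hnhds)).hasFDerivAt hnhds
    have := h2.comp_hasDerivAt t h1
    refine this.congr_deriv ?_
    have : ((1 : ℝ), X') = ((1 : ℝ), (0 : ℝ)) + X' • ((0 : ℝ), (1 : ℝ)) := by simp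
    rw [this, map_add, map_smul, smul_eq_mul]
    ring

theorem continuousOn_along {f : ℝ → ℝ → ℝ} {Ω : Set ℝ} {I : Set ℝ} {X : ℝ → ℝ}
    (hf : ContinuousOn (Function.uncurry f) (Ω ×ˢ univ)) (hI : I ⊆ Ω) (hX : ContinuousOn X I) :
    ContinuousOn (fun t => f t (X t)) I :=
  hf.comp (f := fun t => (t, X t)) (continuousOn_id.prodMk hX)
    fun _ ht => ⟨hI ht, mem_univ _⟩

/-- The bounds on `u` and `u_x` are uniform in space, so Picard–Lindelöf on a ball of radius `M * b`
covers all of `[0, b]` at once. -/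
theorem IsClassC1.exists_characteristic {T b : ℝ} {u : ℝ → ℝ → ℝ} (hu : IsClassC1 T u)
    (hb0 : 0 ≤ b) (hb : b < T) (x : ℝ) :
    ∃ X : ℝ → ℝ, X 0 = x ∧ ContinuousOn X (Icc 0 b) ∧
      ∀ t ∈ Ioo 0 b, HasDerivAt X (u t (X t)) t := by
  obtain ⟨ut, ux, -, -, hux, -⟩ := hu.exists_partials
  obtain ⟨M, hM⟩ := hu.2 b hb
  have hIcc : Icc 0 b ⊆ Ico 0 T := fun t ht => ⟨ht.1, ht.2.trans_lt hb⟩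
  have hM0 : 0 ≤ M := le_trans (by positivity) (hM 0 (left_mem_Icc.2 hb0) 0)
  have hPL : IsPicardLindelof u (tmin := 0) (tmax := b) ⟨0, left_mem_Icc.2 hb0⟩ x
      (M.toNNReal * b.toNNReal) 0 M.toNNReal M.toNNReal := by
    refine ⟨fun t ht => ?_, fun y _ => ?_, fun t ht y _ => ?_, ?_⟩
    · refine (convex_closedBall _ _).lipschitzOnWith_of_nnnorm_hasDerivWithin_le
        (fun y _ => (hux t (hIcc ht) y).hasDerivWithinAt) fun y _ => ?_
      rw [← NNReal.coe_le_coe, coe_nnnorm, Real.coe_toNNReal _ hM0, Real.norm_eq_abs,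
        ← (hux t (hIcc ht) y).deriv]
      have := hM t ht y
      linarith [abs_nonneg (u t y), abs_nonneg (derivWithin (fun τ => u τ y) (Ico 0 T) t)]
    · exact continuousOn_along hu.1.continuousOn hIcc continuousOn_const
    · rw [Real.coe_toNNReal _ hM0, Real.norm_eq_abs]
      have := hM t ht y
      linarith [abs_nonneg (deriv (u t) y), abs_nonneg (derivWithin (fun τ => u τ y) (Ico 0 T) t)]
    · simp [hb0]
  obtain ⟨X, h0, hX⟩ := hPL.exists_eq_forall_mem_Icc_hasDerivWithinAt₀
  exact ⟨X, h0, fun t ht => (hX t ht).continuousWithinAt,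
    fun t ht => (hX t (Ioo_subset_Icc_self ht)).hasDerivAt (Icc_mem_nhds ht.1 ht.2)⟩

/-- Along a characteristic, the velocity gradient satisfies a Riccati equation. -/
theorem hasDerivAt_velocityGradient {ν cm cp T b : ℝ} {c ρ u φ ut ux : ℝ → ℝ → ℝ} {X : ℝ → ℝ}
    (hcm : 0 < cm)
    (hc_cont : ContinuousOn (Function.uncurry c) (Ici 0 ×ˢ univ))
    (hc : ∀ t, 0 ≤ t → ∀ x, cm ≤ c t x ∧ c t x ≤ cp)
    (hb0 : 0 ≤ b) (hb : b < T) (hρ : IsClassC1 T ρ) (hu : IsClassC1 T u)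
    (hmom : ∀ t ∈ Ioo 0 T, ∀ x : ℝ,
      deriv (fun τ => u τ x) t + u t x * deriv (u t) x = -ν * u t x - 1 * deriv (φ t) x)
    (hpois : ∀ t ∈ Ioo 0 T, ∀ x : ℝ, HasDerivAt (deriv (φ t)) (-(ρ t x - c t x)) x)
    (hutc : ContinuousOn (Function.uncurry ut) (Ico 0 T ×ˢ univ))
    (huxc : ContinuousOn (Function.uncurry ux) (Ico 0 T ×ˢ univ))
    (hux : ∀ t ∈ Ico 0 T, ∀ x, HasDerivAt (u t) (ux t x) x)
    (hut : ∀ t ∈ Ioo 0 T, ∀ (X : ℝ → ℝ) (X' : ℝ), HasDerivAt X X' t →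
        HasDerivAt (fun τ => u τ (X τ)) (ut t (X t) + ux t (X t) * X') t)
    (hXc : ContinuousOn X (Icc 0 b)) (hX : ∀ t ∈ Ioo 0 b, HasDerivAt X (u t (X t)) t)
    {t : ℝ} (ht : t ∈ Ioo 0 b) :
    HasDerivAt (fun t => ux t (X t))
      (-ν * ux t (X t) - -(ρ t (X t) - c t (X t)) - ux t (X t) * ux t (X t)) t := by
  have hT : Ioo 0 b ⊆ Ioo 0 T := Ioo_subset_Ioo_right hb.le
  have hT' : Ioo 0 b ⊆ Ico 0 T := hT.trans Ioo_subset_Ico_self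
  have hT0 : Ioo 0 b ⊆ Ici 0 := fun t ht => ht.1.le
  have hXc' : ContinuousOn X (Ioo 0 b) := hXc.mono Ioo_subset_Icc_self
  -- Nothing is assumed on the time regularity of `φ`. The momentum equation expresses `φ_x` through
  -- continuous functions, which makes the difference quotients integrable in time.
  have hφ : ∀ t ∈ Ioo 0 T, ∀ x, deriv (φ t) x = -(ut t x + u t x * ux t x + ν * u t x) := by
    intro t ht x
    have h1 := hmom t ht x
    have h2 := (hut t ht (fun _ => x) 0 (hasDerivAt_const t x)).deriv
    rw [h2, (hux t (Ioo_subset_Ico_self ht) x).deriv] at h1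
    linarith
  obtain ⟨M, hM⟩ := hu.2 b hb
  obtain ⟨M', hM'⟩ := hρ.2 b hb
  have huxM : ∀ t ∈ Ioo 0 b, ∀ x, |ux t x| ≤ M := fun t ht x => by
    rw [← (hux t (hT' ht) x).deriv]
    have := hM t (Ioo_subset_Icc_self ht) x
    linarith [abs_nonneg (u t x), abs_nonneg (derivWithin (fun τ => u τ x) (Ico 0 T) t)]
  have hM0 : 0 ≤ M := le_trans (by positivity) (hM 0 (left_mem_Icc.2 hb0) 0)
  have hρM : ∀ t ∈ Ioo 0 b, ∀ x, |-(ρ t x - c t x)| ≤ M' + cp := fun t ht x => by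
    have := hM' t (Ioo_subset_Icc_self ht) x
    have h1 : |ρ t x| ≤ M' := by
      linarith [abs_nonneg (deriv (ρ t) x), abs_nonneg (derivWithin (fun τ => ρ τ x) (Ico 0 T) t)]
    have h2 : |c t x| ≤ cp := by
      rw [abs_of_nonneg (hcm.le.trans (hc t ht.1.le x).1)]
      exact (hc t ht.1.le x).2
    rw [abs_neg]
    exact (abs_sub _ _).trans (add_le_add h1 h2)
  have hcont : ∀ h : ℝ, ContinuousOn (fun t => X t + h) (Ioo 0 b) := fun h =>
    hXc'.add continuousOn_const
  have huc : ∀ h : ℝ, ContinuousOn (fun t => u t (X t + h)) (Ioo 0 b) := fun h =>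
    continuousOn_along hu.1.continuousOn hT' (hcont h)
  have huxh : ∀ h : ℝ, ContinuousOn (fun t => ux t (X t + h)) (Ioo 0 b) := fun h =>
    continuousOn_along huxc hT' (hcont h)
  have hφc : ∀ h : ℝ, ContinuousOn (fun t => deriv (φ t) (X t + h)) (Ioo 0 b) := fun h => by
    refine ContinuousOn.congr (f := fun t => -(ut t (X t + h) + u t (X t + h) * ux t (X t + h)
      + ν * u t (X t + h))) ?_ fun t ht => hφ t (hT ht) _
    exact (((continuousOn_along hutc hT' (hcont h)).add ((huc h).mul (huxh h))).add
      (continuousOn_const.mul (huc h))).neg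
  have hu0 : ContinuousOn (fun t => u t (X t)) (Ioo 0 b) := by simpa using huc 0
  have hφ0 : ContinuousOn (fun t => deriv (φ t) (X t)) (Ioo 0 b) := by simpa using hφc 0
  have hux0 : ContinuousOn (fun t => ux t (X t)) (Ioo 0 b) := by simpa using huxh 0
  refine hasDerivAt_of_dominated (a := 0) (b := b) (B := |ν| * M + (M' + cp) + M * M)
    (g := fun h t => (u t (X t + h) - u t (X t)) / h)
    (I := fun h t => -ν * ((u t (X t + h) - u t (X t)) / h)
      - (deriv (φ t) (X t + h) - deriv (φ t) (X t)) / h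
      - ux t (X t + h) * ((u t (X t + h) - u t (X t)) / h)) (d := fun t => ux t (X t))
    (I₀ := fun t => -ν * ux t (X t) - -(ρ t (X t) - c t (X t)) - ux t (X t) * ux t (X t))
    ?_ ?_ ?_ ?_ ?_ ?_ ht
  -- Both points `X` and `X + h` move with the velocity `u t (X t)`. Substituting the momentum
  -- equation cancels the common transport and leaves `-ux t (X t + h)` times the difference
  -- quotient, the source of the Riccati term.
  · intro h hh t ht
    have h1 := hut t (hT ht) (fun t => X t + h) _ ((hX t ht).add_const h)
    have h2 := hut t (hT ht) X _ (hX t ht)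
    refine ((h1.sub h2).div_const h).congr_deriv ?_
    rw [hφ t (hT ht), hφ t (hT ht)]
    field_simp
    ring
  · intro h hh
    exact ((continuousOn_const.mul (((huc h).sub hu0).div_const h)).sub
      (((hφc h).sub hφ0).div_const h)).sub ((huxh h).mul (((huc h).sub hu0).div_const h))
  · intro h hh t ht
    have h1 := abs_sub_div_le (hux t (hT' ht)) (huxM t ht) (X t) h
    have h2 := abs_sub_div_le (hpois t (hT ht)) (hρM t ht) (X t) h
    refine (abs_sub _ _).trans (add_le_add ((abs_sub _ _).trans (add_le_add ?_ h2)) ?_)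
    · rw [abs_mul, abs_neg]
      exact mul_le_mul_of_nonneg_left h1 (abs_nonneg _)
    · rw [abs_mul]
      exact mul_le_mul (huxM t ht _) h1 (abs_nonneg _) hM0
  · intro t ht
    exact tendsto_sub_div (hux t (hT' ht) (X t))
  · intro t ht
    have h1 := tendsto_sub_div (hux t (hT' ht) (X t))
    have h2 := tendsto_sub_div (hpois t (hT ht) (X t))
    have h3 : Tendsto (fun h => ux t (X t + h)) (𝓝[≠] 0) (𝓝 (ux t (X t))) := by
      have hcx : Continuous (fun h => ux t (X t + h)) := by
        rw [← continuousOn_univ]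
        exact huxc.comp (f := fun h => (t, X t + h)) (by fun_prop)
          fun _ _ => ⟨hT' ht, mem_univ _⟩
      have := hcx.tendsto 0
      rw [add_zero] at this
      exact this.mono_left nhdsWithin_le_nhds
    exact ((h1.const_mul (-ν)).sub h2).sub (h3.mul h1)
  · have hρ0 := continuousOn_along hρ.1.continuousOn hT' hXc'
    have hc0 := continuousOn_along hc_cont hT0 hXc'
    exact ((continuousOn_const.mul hux0).sub (hρ0.sub hc0).neg).sub (hux0.mul hux0)

/-- Using `r²` instead of `r` makes the weighted quantity `r² * exp (2 M t)` nondecreasing without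
knowing the sign of `r`. So `r` never vanishes, and the intermediate value theorem keeps it
positive. -/
theorem pos_of_hasDerivAt_neg_mul {b M : ℝ} {r d : ℝ → ℝ} (hr : ContinuousOn r (Icc 0 b))
    (hd : ∀ t ∈ Ioo 0 b, HasDerivAt r (-(r t * d t)) t) (hM : ∀ t ∈ Ioo 0 b, d t ≤ M)
    (h0 : 0 < r 0) : ∀ t ∈ Icc 0 b, 0 < r t := by
  have hmono : MonotoneOn (fun t => r t ^ 2 * Real.exp (2 * M * t)) (Icc 0 b) := by
    refine monotoneOn_of_hasDerivWithinAt_nonneg (convex_Icc _ _) (by fun_prop)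
      (f' := fun t => 2 * (r t ^ 2 * Real.exp (2 * M * t)) * (M - d t)) ?_ ?_
    · intro t ht
      rw [interior_Icc] at ht
      have he : HasDerivAt (fun t => Real.exp (2 * M * t)) (Real.exp (2 * M * t) * (2 * M)) t := by
        simpa using ((hasDerivAt_id t).const_mul (2 * M)).exp
      refine ((((hd t ht).pow 2).mul he).congr_deriv ?_).hasDerivWithinAt
      simp
      ring
    · intro t ht
      rw [interior_Icc] at ht
      exact mul_nonneg (by positivity) (sub_nonneg.2 (hM t ht))
  have hne : ∀ t ∈ Icc 0 b, r t ≠ 0 := by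
    intro t ht h
    have := hmono (left_mem_Icc.2 (ht.1.trans ht.2)) ht ht.1
    simp only [h] at this
    have : 0 < r 0 ^ 2 := by positivity
    simp_all
  intro t ht
  by_contra! hle
  obtain ⟨τ, hτ, e⟩ := intermediate_value_Icc' ht.1 (hr.mono (Icc_subset_Icc_right ht.2))
    ⟨hle, h0.le⟩
  exact hne τ ⟨hτ.1, hτ.2.trans ht.2⟩ e

/-- The specific volume along a characteristic is a trajectory of the forced oscillator. -/
theorem IsC1Solution.exists_isTrajectory {ν cm cp T b : ℝ} {c ρ u : ℝ → ℝ → ℝ}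
    (hcm : 0 < cm)
    (hc_cont : ContinuousOn (Function.uncurry c) (Ici 0 ×ˢ univ))
    (hc : ∀ t, 0 ≤ t → ∀ x, cm ≤ c t x ∧ c t x ≤ cp)
    (hsol : IsC1Solution 1 ν c T ρ u) (hb0 : 0 ≤ b) (hb : b < T) {x : ℝ} (hx : 0 < ρ 0 x) :
    ∃ κ s p, IsTrajectory ν b κ s p ∧ (∀ t ∈ Ioo 0 b, cm ≤ κ t ∧ κ t ≤ cp) ∧
      s 0 = 1 / ρ 0 x ∧ p 0 = deriv (u 0) x / ρ 0 x := by
  obtain ⟨hT0, hρ, hu, φ, hφ⟩ := hsol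
  obtain ⟨X, hX0, hXc, hX⟩ := hu.exists_characteristic hb0 hb x
  obtain ⟨ut, ux, hutc, huxc, hux, hut⟩ := hu.exists_partials
  obtain ⟨ρt, ρx, -, -, hρx, hρt⟩ := hρ.exists_partials
  have hT : Ioo 0 b ⊆ Ioo 0 T := Ioo_subset_Ioo_right hb.le
  have hIcc : Icc 0 b ⊆ Ico 0 T := fun t ht => ⟨ht.1, ht.2.trans_lt hb⟩
  have hrc : ContinuousOn (fun t => ρ t (X t)) (Icc 0 b) :=
    continuousOn_along hρ.1.continuousOn hIcc hXc
  have hdc : ContinuousOn (fun t => ux t (X t)) (Icc 0 b) := continuousOn_along huxc hIcc hXc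
  have hd : ∀ t ∈ Ioo 0 b, HasDerivAt (fun t => ux t (X t))
      (-ν * ux t (X t) - -(ρ t (X t) - c t (X t)) - ux t (X t) * ux t (X t)) t := fun t ht =>
    hasDerivAt_velocityGradient hcm hc_cont hc hb0 hb hρ hu (fun t ht x => (hφ t ht x).2.1)
      (fun t ht x => (hφ t ht x).2.2.2) hutc huxc hux hut hXc hX ht
  have hr : ∀ t ∈ Ioo 0 b, HasDerivAt (fun t => ρ t (X t)) (-(ρ t (X t) * ux t (X t))) t := by
    intro t ht
    refine (hρt t (hT ht) X _ (hX t ht)).congr_deriv ?_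
    have h1 := (hφ t (hT ht) (X t)).1
    have h2 := (hρt t (hT ht) (fun _ => X t) 0 (hasDerivAt_const t _)).deriv
    have h3 := ((hρx t (Ioo_subset_Ico_self (hT ht)) (X t)).mul
      (hux t (Ioo_subset_Ico_self (hT ht)) (X t))).deriv
    have h4 : deriv (fun y => ρ t y * u t y) (X t)
        = ρx t (X t) * u t (X t) + ρ t (X t) * ux t (X t) := h3
    rw [h2, h4] at h1
    linarith
  obtain ⟨M, hM⟩ := hu.2 b hb
  have hpos : ∀ t ∈ Icc 0 b, 0 < ρ t (X t) := by
    refine pos_of_hasDerivAt_neg_mul hrc hr (M := M) (fun t ht => ?_) (by rwa [hX0])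
    rw [← (hux t (Ioo_subset_Ico_self (hT ht)) (X t)).deriv]
    have := hM t (Ioo_subset_Icc_self ht) (X t)
    linarith [abs_nonneg (u t (X t)), le_abs_self (deriv (u t) (X t)),
      abs_nonneg (derivWithin (fun τ => u τ (X t)) (Ico 0 T) t)]
  have hsc : ContinuousOn (fun t => (ρ t (X t))⁻¹) (Icc 0 b) :=
    hrc.inv₀ fun t ht => (hpos t ht).ne'
  have hs : ∀ t ∈ Ioo 0 b, HasDerivAt (fun t => (ρ t (X t))⁻¹)
      (ux t (X t) * (ρ t (X t))⁻¹) t := fun t ht => by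
    have hp := (hpos t (Ioo_subset_Icc_self ht)).ne'
    refine ((hr t ht).inv hp).congr_deriv ?_
    field_simp
  refine ⟨fun t => c t (X t), fun t => (ρ t (X t))⁻¹, fun t => ux t (X t) * (ρ t (X t))⁻¹,
    ⟨hsc, hdc.mul hsc, hs, fun t ht => ?_, fun t ht => inv_pos.2 (hpos t ht)⟩,
    fun t ht => hc t ht.1.le _, by simp [hX0], ?_⟩
  · have hp := (hpos t (Ioo_subset_Icc_self ht)).ne'
    refine ((hd t ht).mul (hs t ht)).congr_deriv ?_
    field_simp
    ring
  · simp only [hX0]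
    rw [(hux 0 ⟨le_rfl, hT0⟩ x).deriv, div_eq_mul_inv]

end EulerPoisson

theorem theorem1p6 (ν cm cp : ℝ) (hν : 0 ≤ ν) (hcm : 0 < cm)
    (c : ℝ → ℝ → ℝ)
    (hc_cont : ContinuousOn (Function.uncurry c) (Set.Ici 0 ×ˢ Set.univ))
    (hc : ∀ t, 0 ≤ t → ∀ x, cm ≤ c t x ∧ c t x ≤ cp)
    (ρ₀ u₀ : ℝ → ℝ) (x : ℝ) (hρ₀ : 0 < ρ₀ x)
    (hviol : ¬ ((1 / ρ₀ x ∈ EulerPoisson.domP ν cm ∧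
          -(ρ₀ x) * √(2 * EulerPoisson.P ν cm (1 / ρ₀ x)) < deriv u₀ x) ∧
        (ν < 2 * √cm →
          1 / ρ₀ x ∈ EulerPoisson.domN ν cp (EulerPoisson.sTilde ν cm) ∧
          deriv u₀ x <
            ρ₀ x * √(2 * EulerPoisson.N ν cp (EulerPoisson.sTilde ν cm) (1 / ρ₀ x))))) :
    ∃ Tstar : ℝ, 0 < Tstar ∧
      ∀ (T : ℝ) (ρ u : ℝ → ℝ → ℝ), EulerPoisson.IsC1Solution 1 ν c T ρ u →
        (∀ y, ρ 0 y = ρ₀ y ∧ u 0 y = u₀ y) → T ≤ Tstar := by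
  have hcmp : cm ≤ cp := (hc 0 le_rfl 0).1.trans (hc 0 le_rfl 0).2
  -- Dividing the threshold inequalities by `ρ₀ x` puts them in terms of the initial phase point
  -- `(1/ρ₀, u₀'/ρ₀)`.
  obtain ⟨Tstar, hT, H⟩ := EulerPoisson.exists_breakdown_time (s₀ := 1 / ρ₀ x)
    (p₀ := deriv u₀ x / ρ₀ x) hν hcm hcmp (one_div_pos.2 hρ₀) (by
      rwa [lt_div_iff₀ hρ₀, div_lt_iff₀ hρ₀, neg_mul, mul_comm _ (ρ₀ x), ← neg_mul,
        mul_comm _ (ρ₀ x)])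
  refine ⟨Tstar, hT, fun T ρ u hsol h0 => ?_⟩
  by_contra! hlt
  have hu0 : u 0 = u₀ := funext fun y => (h0 y).2
  -- If `T > Tstar`, the trajectory exists on `[0, b]` with `b = Tstar` itself, and the strict bound
  -- `b < Tstar` is contradictory.
  obtain ⟨κ, s, p, hs, hκ, e1, e2⟩ := hsol.exists_isTrajectory hcm hc_cont hc hT.le hlt
    (x := x) (by rwa [(h0 x).1])
  rw [(h0 x).1] at e1 e2
  rw [hu0] at e2
  exact lt_irrefl _ (H Tstar κ s p hs hκ e1 e2)
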